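/- **Theorem (restricted comparison principle).** Let $H:\mathbb R\to\mathbb R$ be continuous, let $F:\mathbb R\to\mathbb R$ be of class $C^1$ with $F'<0$ on $\mathbb R$, $F(0)=0$, $\lim_{p\to-\infty}F(p)=+\infty$ and $\lim_{p\to+\infty}F(p)=-\infty$, and let $u_0:[0,+\infty)\to\mathbb R$ be uniformly continuous. For $T>0$ consider the problem $$u_t+H(u_x)=0\ \text{ for } t\in(0,T),\ x>0,\qquad u_t+F(u_x)=0\ \text{ for } t\in(0,T),\ x=0,\qquad u(0,x)=u_0(x)\ \text{ for } x\ge 0. \tag{P}$$ For $w:[0,T)\times[0,+\infty)\to\mathbb R$ let $$w^*(t,x)=\limsup_{(s,y)\to(t,x)}w(s,y),\qquad w_*(t,x)=\liminf_{(s,y)\to(t,x)}w(s,y)$$ be its upper and lower semi-continuous envelopes (with values in $[-\infty,+\infty]$; the limits are taken over points $(s,y)\in[0,T)\times[0,+\infty)$, with $(s,y)=(t,x)$ allowed). The function $w$ is a *relaxed sub-solution* of (P) if $w^*(0,x)\le u_0(x)$ for all $x\ge0$ and, for every $\phi\in C^1((0,T)\times[0,+\infty))$ and every $(t_0,x_0)\in(0,T)\times[0,+\infty)$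 at which $w^*-\phi$ has a local maximum relative to $(0,T)\times[0,+\infty)$, * if $x_0>0$, then $\phi_t(t_0,x_0)+H(\phi_x(t_0,x_0))\le0$; * if $x_0=0$, then $\phi_t(t_0,0)+H(\phi_x(t_0,0))\le0$ or $\phi_t(t_0,0)+F(\phi_x(t_0,0))\le0$. It is a *relaxed super-solution* of (P) if $w_*(0,x)\ge u_0(x)$ for all $x\ge0$ and the same holds with $w_*$, "local minimum" and $\ge0$ in place of $w^*$, "local maximum" and $\le0$. (At $x_0=0$, $\phi_x$ is the right derivative.) Let $T>0$, let $u$ be a relaxed sub-solution and $v$ a relaxed super-solution of (P), and suppose that for some $C_T>0$ $$u(t,x)\le C_T(1+x),\qquad v(t,x)\ge -C_T(1+x)\qquad\text{for all }(t,x)\in(0,T)\times[0,+\infty).$$ Then $u\le v$ in $[0,T)\times[0,+\infty)$. -/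

import Mathlib

open Set Filter Topology

noncomputable section

namespace HalfLineHJ

/-- The space-time domain `[0,T) × [0,+∞)`; points are pairs `(t, x)`. -/
def domain (T : ℝ) : Set (ℝ × ℝ) := Ico 0 T ×ˢ Ici 0

/-- The set `(0,T) × [0,+∞)` on which the equation is posed. -/
def openDomain (T : ℝ) : Set (ℝ × ℝ) := Ioo 0 T ×ˢ Ici 0

/-- The upper semi-continuous envelope `u^*` of a function `u` on `[0,T) × [0,+∞)`, with values in
the extended reals. The upper limit is over points of the domain, the centre included. -/
def upperEnvelope (T : ℝ) (u : ℝ × ℝ → ℝ) (z : ℝ × ℝ) : EReal :=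
  limsup (fun w => (u w : EReal)) (𝓝[domain T] z)

/-- The lower semi-continuous envelope `u_*` of a function `u` on `[0,T) × [0,+∞)`. -/
def lowerEnvelope (T : ℝ) (u : ℝ × ℝ → ℝ) (z : ℝ × ℝ) : EReal :=
  liminf (fun w => (u w : EReal)) (𝓝[domain T] z)

/-- The time derivative `φ_t(t,x)`. -/
def timeDeriv (φ : ℝ × ℝ → ℝ) (z : ℝ × ℝ) : ℝ :=
  deriv (fun s => φ (s, z.2)) z.1

/-- The space derivative `φ_x(t,x)` on `x ≥ 0`; it is the right derivative at `x = 0`. -/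
def spaceDeriv (φ : ℝ × ℝ → ℝ) (z : ℝ × ℝ) : ℝ :=
  derivWithin (fun y => φ (z.1, y)) (Ici 0) z.2

/-- `φ` touches `f` from above at `z`: `f - φ` has a local maximum at `z`. -/
def TouchesFromAbove (T : ℝ) (φ : ℝ × ℝ → ℝ) (f : ℝ × ℝ → EReal) (z : ℝ × ℝ) : Prop :=
  IsLocalMaxOn (fun w => f w - (φ w : EReal)) (openDomain T) z

/-- `φ` touches `f` from below at `z`: `f - φ` has a local minimum at `z`. -/
def TouchesFromBelow (T : ℝ) (φ : ℝ × ℝ → ℝ) (f : ℝ × ℝ → EReal) (z : ℝ × ℝ) : Prop :=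
  IsLocalMinOn (fun w => f w - (φ w : EReal)) (openDomain T) z

/-- `u` is a relaxed sub-solution of `u_t + H(u_x) = 0` for `x > 0`, `u_t + F(u_x) = 0` for
`x = 0`, with initial condition `u(0,x) = u₀(x)`, on `[0,T) × [0,+∞)`. -/
structure IsRelaxedSubsolution (H F u₀ : ℝ → ℝ) (T : ℝ) (u : ℝ × ℝ → ℝ) : Prop where
  interior : ∀ φ : ℝ × ℝ → ℝ, ContDiffOn ℝ 1 φ (openDomain T) → ∀ z ∈ openDomain T,
    TouchesFromAbove T φ (upperEnvelope T u) z → 0 < z.2 →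
      timeDeriv φ z + H (spaceDeriv φ z) ≤ 0
  boundary : ∀ φ : ℝ × ℝ → ℝ, ContDiffOn ℝ 1 φ (openDomain T) → ∀ z ∈ openDomain T,
    TouchesFromAbove T φ (upperEnvelope T u) z → z.2 = 0 →
      timeDeriv φ z + H (spaceDeriv φ z) ≤ 0 ∨ timeDeriv φ z + F (spaceDeriv φ z) ≤ 0
  initial : ∀ x : ℝ, 0 ≤ x → upperEnvelope T u (0, x) ≤ (u₀ x : EReal)

/-- `v` is a relaxed super-solution of `v_t + H(v_x) = 0` for `x > 0`, `v_t + F(v_x) = 0` for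
`x = 0`, with initial condition `v(0,x) = u₀(x)`, on `[0,T) × [0,+∞)`. -/
structure IsRelaxedSupersolution (H F u₀ : ℝ → ℝ) (T : ℝ) (v : ℝ × ℝ → ℝ) : Prop where
  interior : ∀ φ : ℝ × ℝ → ℝ, ContDiffOn ℝ 1 φ (openDomain T) → ∀ z ∈ openDomain T,
    TouchesFromBelow T φ (lowerEnvelope T v) z → 0 < z.2 →
      0 ≤ timeDeriv φ z + H (spaceDeriv φ z)
  boundary : ∀ φ : ℝ × ℝ → ℝ, ContDiffOn ℝ 1 φ (openDomain T) → ∀ z ∈ openDomain T,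
    TouchesFromBelow T φ (lowerEnvelope T v) z → z.2 = 0 →
      0 ≤ timeDeriv φ z + H (spaceDeriv φ z) ∨ 0 ≤ timeDeriv φ z + F (spaceDeriv φ z)
  initial : ∀ x : ℝ, 0 ≤ x → (u₀ x : EReal) ≤ lowerEnvelope T v (0, x)

end HalfLineHJ

end

/-!
The proof doubles the variables. Replacing `v` by `-v` turns the super-solution into a sub-solution
for `p ↦ -H (-p)`, `p ↦ -F (-p)`, so it is enough to study the upper envelopes `U` of `u` and `W` of
`-v`, which are finite on the domain, and to show `U + W ≤ 0`.

Barriers: sub-solutions of linear growth that lie below a smooth Lipschitz function `g` initially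
stay below `g + C₁ t` (`IsViscositySubsolution.exists_le_add_mul`). Applied to smooth approximations
of `u₀`, this shows that the initial datum is attained uniformly in `x`
(`IsViscositySubsolution.exists_le_initial`), and that `U(t, x) + W(s, y)` is bounded by
`L |x - y| + K`. In particular the localisation `α x²` used below has a gradient tending to `0` with
`α` at the maximum points. This takes the place of coercivity of `H`, which is not assumed.

Boundary condition: let `G a = F⁻¹(-a)`, a `C¹` function. The doubled variables are penalised by
`ψ(t - s, x - y)`, where `ψ(τ, ξ) = τ² / (2δ) + G(τ/δ) ξ + ξ² / (2ε)` (`penalty`). On `ξ = 0` it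
solves `ψ_τ + F(ψ_ξ) = 0` exactly, and as `F` is decreasing, `ψ_τ + F(ψ_ξ)` has the sign of `-ξ` for
`ε` and `ξ` small with respect to `δ` (`exists_boundary_sign`). If the maximum point of the doubled
function has `x = 0`, then `ξ ≤ 0`, and the strict inequality gained from the term `η / (T - t)`
excludes the alternative with `F` for `U`; if `y = 0`, then `ξ ≥ 0`, and the one for `W` is
excluded. What remains are two inequalities for `H` at slopes that lie in a compact set depending on
`δ` and `ε` only and differ by `2 α x` (`viscosity_inequality_of_max`). They contradict each other
as `α → 0`, by continuity of `H`.
-/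

namespace HalfLineHJ

variable {H F u₀ : ℝ → ℝ} {T C : ℝ} {u : ℝ × ℝ → ℝ}

/-! ### Semi-continuous envelopes -/

/-- The upper semi-continuous envelope as a real-valued function. It agrees with `upperEnvelope`
on the domain as soon as the latter is finite there, and is junk elsewhere. -/
noncomputable def realEnvelope (T : ℝ) (u : ℝ × ℝ → ℝ) (z : ℝ × ℝ) : ℝ :=
  (upperEnvelope T u z).toReal

lemma le_upperEnvelope {z : ℝ × ℝ} (hz : z ∈ domain T) : (u z : EReal) ≤ upperEnvelope T u z := by
  refine le_limsup_of_frequently_le' fun h => ?_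
  exact (h.self_of_nhdsWithin hz) le_rfl

lemma upperEnvelope_le_linear
    (hub : ∀ t x : ℝ, 0 < t → t < T → 0 ≤ x → u (t, x) ≤ C * (1 + x))
    {t x : ℝ} (ht : 0 < t) : upperEnvelope T u (t, x) ≤ ((C * (1 + x) : ℝ) : EReal) := by
  refine le_of_forall_gt fun b hb => ?_
  obtain ⟨c, hc, hcb⟩ := EReal.lt_iff_exists_real_btwn.1 hb
  refine lt_of_le_of_lt (limsup_le_of_le (by isBoundedDefault) ?_) hcb
  have hcont : ContinuousAt (fun w : ℝ × ℝ => C * (1 + w.2)) (t, x) := by fun_prop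
  have h1 : ∀ᶠ w : ℝ × ℝ in 𝓝 (t, x), C * (1 + w.2) < c :=
    hcont.eventually_lt_const (EReal.coe_lt_coe_iff.1 hc)
  have h2 : ∀ᶠ w : ℝ × ℝ in 𝓝 (t, x), 0 < w.1 :=
    continuousAt_fst.eventually_const_lt ht
  filter_upwards [nhdsWithin_le_nhds h1, nhdsWithin_le_nhds h2, self_mem_nhdsWithin] with w h1 h2 hw
  exact EReal.coe_le_coe_iff.2 ((hub w.1 w.2 h2 hw.1.2 hw.2).trans h1.le)

lemma coe_realEnvelope
    (hub : ∀ t x : ℝ, 0 < t → t < T → 0 ≤ x → u (t, x) ≤ C * (1 + x))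
    (hinit : ∀ x : ℝ, 0 ≤ x → upperEnvelope T u (0, x) ≤ (u₀ x : EReal))
    {z : ℝ × ℝ} (hz : z ∈ domain T) : (realEnvelope T u z : EReal) = upperEnvelope T u z := by
  refine EReal.coe_toReal ?_ ((EReal.bot_lt_coe _).trans_le (le_upperEnvelope hz)).ne'
  obtain ⟨t, x⟩ := z
  rcases hz.1.1.eq_or_lt with h | h
  · obtain rfl : 0 = t := h
    exact ((hinit x hz.2).trans_lt (EReal.coe_lt_top _)).ne
  · exact ((upperEnvelope_le_linear hub h).trans_lt (EReal.coe_lt_top _)).ne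

lemma upperSemicontinuousOn_realEnvelope
    (hfin : ∀ z ∈ domain T, (realEnvelope T u z : EReal) = upperEnvelope T u z) :
    UpperSemicontinuousOn (realEnvelope T u) (domain T) := by
  intro z hz y hy
  obtain ⟨c, hc, hcy⟩ := exists_between hy
  have h1 : upperEnvelope T u z < (c : EReal) := by
    rw [← hfin z hz]; exact EReal.coe_lt_coe_iff.2 hc
  have h2 := eventually_eventually_nhdsWithin.2
    (eventually_lt_of_limsup_lt h1 (by isBoundedDefault))
  filter_upwards [h2, self_mem_nhdsWithin] with w hw hwd
  refine lt_of_le_of_lt ?_ hcy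
  rw [← EReal.coe_le_coe_iff, hfin w hwd]
  exact limsup_le_of_le (by isBoundedDefault) (hw.mono fun _ h => h.le)

lemma upperEnvelope_neg (T : ℝ) (v : ℝ × ℝ → ℝ) (z : ℝ × ℝ) :
    upperEnvelope T (fun w => -v w) z = -lowerEnvelope T v z := by
  rw [upperEnvelope, lowerEnvelope, ← EReal.limsup_neg]
  congr 1

/-- The substitution `v ↦ -v` turns super-solutions into sub-solutions for the Hamiltonians
`p ↦ -H (-p)` and `p ↦ -F (-p)`; the latter is again decreasing. -/
lemma IsRelaxedSupersolution.neg {v : ℝ × ℝ → ℝ} (hv : IsRelaxedSupersolution H F u₀ T v) :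
    IsRelaxedSubsolution (fun p => -H (-p)) (fun p => -F (-p)) (fun x => -u₀ x) T
      (fun w => -v w) := by
  have touch : ∀ (φ : ℝ × ℝ → ℝ) (z : ℝ × ℝ),
      TouchesFromAbove T φ (upperEnvelope T fun w => -v w) z →
      TouchesFromBelow T (fun w => -φ w) (lowerEnvelope T v) z := by
    intro φ z h
    have h' : IsLocalMaxOn (fun w => upperEnvelope T (fun w => -v w) w - (φ w : EReal))
      (openDomain T) z := h
    filter_upwards [h'] with w hw
    simp only [upperEnvelope_neg] at hw
    have key : ∀ w, -lowerEnvelope T v w - (φ w : EReal)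
        = -(lowerEnvelope T v w - ((-φ w : ℝ) : EReal)) := by
      intro w
      rw [EReal.neg_sub (Or.inr (EReal.coe_ne_bot _)) (Or.inr (EReal.coe_ne_top _))]
      simp [sub_eq_add_neg]
    rw [key, key, EReal.neg_le_neg_iff] at hw
    exact hw
  have ht : ∀ (φ : ℝ × ℝ → ℝ) (z : ℝ × ℝ), timeDeriv (fun w => -φ w) z = -timeDeriv φ z := by
    intro φ z; simp [timeDeriv]
  have hs : ∀ (φ : ℝ × ℝ → ℝ) (z : ℝ × ℝ), spaceDeriv (fun w => -φ w) z = -spaceDeriv φ z := by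
    intro φ z; exact derivWithin.fun_neg
  refine ⟨fun φ hφ z hz hmax h0 => ?_, fun φ hφ z hz hmax h0 => ?_, fun x hx => ?_⟩
  · have := hv.interior _ hφ.neg z hz (touch φ z hmax) h0
    rw [ht, hs] at this
    linarith
  · have := hv.boundary _ hφ.neg z hz (touch φ z hmax) h0
    rw [ht, hs] at this
    exact this.imp (fun h => by linarith) (fun h => by linarith)
  · rw [upperEnvelope_neg, EReal.coe_neg, EReal.neg_le_neg_iff]
    exact hv.initial x hx

/-! ### Real-valued viscosity sub-solutions -/

/-- The viscosity inequalities of a relaxed sub-solution, for a real-valued function `U` (in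
practice an upper semi-continuous envelope) and test functions touching `U` from above globally.
The interior and boundary inequalities are merged, and the derivatives of the test function
are given as numbers `a` and `p`. -/
def IsViscositySubsolution (H F : ℝ → ℝ) (T : ℝ) (U : ℝ × ℝ → ℝ) : Prop :=
  ∀ φ : ℝ × ℝ → ℝ, ContDiffOn ℝ 1 φ (openDomain T) → ∀ z ∈ openDomain T,
    (∀ w ∈ openDomain T, U w - φ w ≤ U z - φ z) →
    ∀ a p : ℝ, HasDerivAt (fun s => φ (s, z.2)) a z.1 → HasDerivAt (fun y => φ (z.1, y)) p z.2 →
      a + H p ≤ 0 ∨ (z.2 = 0 ∧ a + F p ≤ 0)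

lemma openDomain_subset_domain : openDomain T ⊆ domain T :=
  fun _ hz => ⟨⟨hz.1.1.le, hz.1.2⟩, hz.2⟩

lemma IsRelaxedSubsolution.isViscositySubsolution (hu : IsRelaxedSubsolution H F u₀ T u)
    (hfin : ∀ z ∈ domain T, (realEnvelope T u z : EReal) = upperEnvelope T u z) :
    IsViscositySubsolution H F T (realEnvelope T u) := by
  intro φ hφ z hz hmax a p ha hp
  have ht : timeDeriv φ z = a := ha.deriv
  have hx : spaceDeriv φ z = p :=
    hp.hasDerivWithinAt.derivWithin (uniqueDiffOn_Ici 0 _ hz.2)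
  have touch : TouchesFromAbove T φ (upperEnvelope T u) z := by
    have : ∀ᶠ w in 𝓝[openDomain T] z, upperEnvelope T u w - (φ w : EReal)
        ≤ upperEnvelope T u z - (φ z : EReal) := by
      filter_upwards [self_mem_nhdsWithin] with w hw
      rw [← hfin w (openDomain_subset_domain hw), ← hfin z (openDomain_subset_domain hz)]
      exact_mod_cast hmax w hw
    exact this
  rcases (show (0 : ℝ) ≤ z.2 from hz.2).eq_or_lt with h0 | h0
  · rcases hu.boundary φ hφ z hz touch h0.symm with h | h
    · exact Or.inl (by rwa [ht, hx] at h)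
    · exact Or.inr ⟨h0.symm, by rwa [ht, hx] at h⟩
  · have h := hu.interior φ hφ z hz touch h0
    exact Or.inl (by rwa [ht, hx] at h)

end HalfLineHJ

namespace HalfLineHJ

/-! ### Regularisation of the initial datum -/

/-- A uniformly continuous function on the half line is a uniform limit of `C¹` functions with
bounded derivative. -/
lemma exists_contDiff_approx {u₀ : ℝ → ℝ} (hu₀ : UniformContinuousOn u₀ (Ici 0)) {e : ℝ}
    (he : 0 < e) :
    ∃ g : ℝ → ℝ, ∃ L : ℝ, 0 ≤ L ∧ ContDiff ℝ 1 g ∧ (∀ x, |deriv g x| ≤ L) ∧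
      ∀ x, 0 ≤ x → |u₀ x - g x| ≤ e := by
  obtain ⟨d, hd, hdu⟩ := Metric.uniformContinuousOn_iff.1 hu₀ e he
  -- `f` extends `u₀` by a constant, `h` is the width of the averaging window.
  set f : ℝ → ℝ := fun x => u₀ (max x 0) with hf
  have hfd : ∀ x y, |x - y| < d → |f x - f y| < e := by
    intro x y hxy
    refine hdu _ (mem_Ici.2 (le_max_right _ _)) _ (mem_Ici.2 (le_max_right _ _)) ?_
    exact lt_of_le_of_lt (abs_max_sub_max_le_abs x y 0) hxy
  have hfc : Continuous f := by
    refine hu₀.continuousOn.comp_continuous (by fun_prop) fun x => mem_Ici.2 (le_max_right _ _)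
  set h := d / 2 with hh
  have hh0 : 0 < h := by positivity
  have hder : ∀ x, HasDerivAt (fun x => h⁻¹ * ((∫ y in (0:ℝ)..(x + h), f y) - ∫ y in (0:ℝ)..x, f y))
      (h⁻¹ * (f (x + h) - f x)) x := by
    intro x
    have h1 := (hfc.integral_hasStrictDerivAt 0 (x + h)).hasDerivAt.comp_add_const x h
    have h2 := (hfc.integral_hasStrictDerivAt 0 x).hasDerivAt
    exact (h1.sub h2).const_mul _
  refine ⟨fun x => h⁻¹ * ((∫ y in (0:ℝ)..(x + h), f y) - ∫ y in (0:ℝ)..x, f y), h⁻¹ * e,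
    by positivity, ?_, fun x => ?_, fun x hx => ?_⟩
  · rw [contDiff_one_iff_deriv]
    refine ⟨fun x => (hder x).differentiableAt, ?_⟩
    rw [show deriv _ = fun x => h⁻¹ * (f (x + h) - f x) from funext fun x => (hder x).deriv]
    fun_prop
  · rw [(hder x).deriv, abs_mul, abs_of_pos (inv_pos.2 hh0)]
    refine mul_le_mul_of_nonneg_left (hfd _ _ ?_).le (by positivity)
    rw [add_sub_cancel_left, abs_of_pos hh0]
    linarith
  · beta_reduce
    rw [intervalIntegral.integral_interval_sub_left (hfc.intervalIntegrable _ _)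
      (hfc.intervalIntegrable _ _)]
    have hfx : u₀ x = f x := by simp [hf, max_eq_left hx]
    have h1 : u₀ x - h⁻¹ * ∫ y in x..(x + h), f y = h⁻¹ * ∫ y in x..(x + h), (f x - f y) := by
      rw [intervalIntegral.integral_sub (by simp) (hfc.intervalIntegrable _ _), hfx]
      simp
      field_simp
    rw [h1, abs_mul, abs_of_pos (inv_pos.2 hh0)]
    have h2 : ‖∫ y in x..(x + h), (f x - f y)‖ ≤ e * |x + h - x| := by
      refine intervalIntegral.norm_integral_le_of_norm_le_const fun y hy => ?_
      rw [uIoc_of_le (by linarith)] at hy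
      refine (hfd x y ?_).le
      rw [abs_sub_comm, abs_of_pos (by linarith [hy.1])]
      linarith [hy.2]
    rw [add_sub_cancel_left, abs_of_pos hh0, Real.norm_eq_abs] at h2
    calc h⁻¹ * _ ≤ h⁻¹ * (e * h) := mul_le_mul_of_nonneg_left h2 (by positivity)
      _ = e := by field_simp

/-! ### The inverse boundary Hamiltonian -/

/-- The function `G a = F⁻¹(-a)`, as a `C¹` function. -/
lemma exists_contDiff_section {F : ℝ → ℝ} (hF : ContDiff ℝ 1 F) (hF' : ∀ p, deriv F p < 0)
    (hFbot : Tendsto F atBot atTop) (hFtop : Tendsto F atTop atBot) :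
    ∃ G : ℝ → ℝ, ContDiff ℝ 1 G ∧ ∀ a, F (G a) = -a := by
  set f : ℝ → ℝ := fun p => -F p with hf
  have hmono : StrictMono f := (strictAnti_of_deriv_neg hF').neg
  have hcont : Continuous f := hF.continuous.neg
  have hsurj : Function.Surjective f :=
    hcont.surjective (tendsto_neg_atBot_atTop.comp hFtop) (tendsto_neg_atTop_atBot.comp hFbot)
  set e : ℝ ≃ₜ ℝ := (hmono.orderIsoOfSurjective f hsurj).toHomeomorph with he
  have hef : ∀ p, e p = f p := fun p => rfl
  refine ⟨e.symm, ?_, fun a => ?_⟩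
  · refine e.contDiff_symm_deriv (f' := fun p => -deriv F p) (fun p => ?_) (fun p => ?_) ?_
    · exact (neg_pos.2 (hF' p)).ne'
    · exact ((hF.differentiable one_ne_zero) p).hasDerivAt.neg
    · exact hF.neg
  · have h := e.apply_symm_apply a
    rw [hef] at h
    simp only [hf] at h
    linarith

/-- Let `ψ(τ, ξ) = τ² / (2δ) + G(τ/δ) ξ + ξ² / (2ε)` and `a = τ / δ`. If `ε` and `ξ` are small,
then `ψ_τ + F(ψ_ξ)` has the sign of `-ξ`: the term `ξ / ε` moves `F` away from
`F (G a) = -a` by more than the error `G'(a) ξ / δ`. -/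
lemma exists_boundary_sign {F G : ℝ → ℝ} (hF : ContDiff ℝ 1 F) (hF' : ∀ p, deriv F p < 0)
    (hG : ContDiff ℝ 1 G) (hFG : ∀ a, F (G a) = -a) (A : ℝ) {δ : ℝ} (hδ : 0 < δ) :
    ∃ κ : ℝ, 0 < κ ∧ ∀ ε, 0 < ε → ε ≤ κ → ∀ a ξ : ℝ, |a| ≤ A → |ξ| ≤ κ →
      (ξ ≤ 0 → 0 ≤ a + deriv G a * ξ / δ + F (G a + ξ / ε)) ∧
      (0 ≤ ξ → a + deriv G a * ξ / δ + F (G a + ξ / ε) ≤ 0) := by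
  have hG'c : Continuous (deriv G) := hG.continuous_deriv le_rfl
  have hF'c : Continuous (deriv F) := hF.continuous_deriv le_rfl
  obtain ⟨R, hR⟩ := (isCompact_Icc (a := -A) (b := A)).exists_bound_of_continuousOn
    hG.continuous.continuousOn
  obtain ⟨D, hD⟩ := (isCompact_Icc (a := -A) (b := A)).exists_bound_of_continuousOn
    hG'c.continuousOn
  -- `ν` is a lower bound for `|F'|` on the `1`-neighbourhood of the values of `G`.
  obtain ⟨ν, hν, hFν⟩ : ∃ ν > 0, ∀ p ∈ Icc (-(|R| + 1)) (|R| + 1), deriv F p ≤ -ν := by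
    obtain ⟨q, -, hq⟩ := (isCompact_Icc (a := -(|R| + 1)) (b := |R| + 1)).exists_isMaxOn
      ⟨0, by constructor <;> linarith [abs_nonneg R]⟩ hF'c.continuousOn
    exact ⟨-deriv F q, by linarith [hF' q], fun p hp => by simpa using hq hp⟩
  have hanti := strictAnti_of_deriv_neg hF'
  have hmvt : ∀ p ∈ Icc (-(|R| + 1)) (|R| + 1), ∀ q ∈ Icc (-(|R| + 1)) (|R| + 1), p ≤ q →
      F q - F p ≤ -ν * (q - p) := by
    intro p hp q hq hpq
    refine (convex_Icc _ _).image_sub_le_mul_sub_of_deriv_le hF.continuous.continuousOn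
      (hF.differentiable one_ne_zero).differentiableOn (fun x hx => ?_) p hp q hq hpq
    exact hFν x (interior_subset hx)
  set κ := ν * δ / (|D| + 1) with hκ
  have hκ0 : 0 < κ := by positivity
  refine ⟨κ, hκ0, fun ε hε hεκ a ξ ha hξ => ?_⟩
  have ha' : a ∈ Icc (-A) A := abs_le.1 ha
  have hGa := abs_le.1 ((hR a ha').trans (le_abs_self R))
  have hDa : |deriv G a| ≤ |D| + 1 := ((hD a ha').trans (le_abs_self D)).trans (by linarith)
  have hκD : κ * (|D| + 1) / δ = ν := by rw [hκ]; field_simp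
  have herr1 : |deriv G a * ξ / δ| ≤ ν := by
    rw [abs_div, abs_mul, abs_of_pos hδ, ← hκD, mul_comm κ]
    gcongr
  have herr2 : |deriv G a * ξ / δ| ≤ ν * (|ξ| / ε) := by
    rw [abs_div, abs_mul, abs_of_pos hδ, div_le_iff₀ hδ]
    have h1 : |D| + 1 = ν * δ / κ := by rw [hκ]; field_simp
    have h2 : |deriv G a| ≤ ν * δ / ε := by
      refine (hDa.trans h1.le).trans ?_
      gcongr
    calc |deriv G a| * |ξ| ≤ ν * δ / ε * |ξ| := by gcongr
      _ = ν * (|ξ| / ε) * δ := by ring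
  have hmem : G a ∈ Icc (-(|R| + 1)) (|R| + 1) := ⟨by linarith [hGa.1], by linarith [hGa.2]⟩
  rcases le_total (|ξ| / ε) 1 with h1 | h1
  · have hb : |ξ / ε| ≤ 1 := by rwa [abs_div, abs_of_pos hε]
    have hb' := abs_le.1 hb
    have hmem' : G a + ξ / ε ∈ Icc (-(|R| + 1)) (|R| + 1) :=
      ⟨by linarith [hGa.1], by linarith [hGa.2]⟩
    refine ⟨fun h0 => ?_, fun h0 => ?_⟩
    · have hq : ξ / ε ≤ 0 := div_nonpos_of_nonpos_of_nonneg h0 hε.le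
      have := hmvt _ hmem' _ hmem (by linarith)
      rw [abs_of_nonpos h0, neg_div] at herr2
      rw [hFG] at this
      nlinarith [(abs_le.1 herr2).1]
    · have hq : 0 ≤ ξ / ε := by positivity
      have := hmvt _ hmem _ hmem' (by linarith)
      rw [abs_of_nonneg h0] at herr2
      rw [hFG] at this
      nlinarith [(abs_le.1 herr2).2]
  · refine ⟨fun h0 => ?_, fun h0 => ?_⟩
    · rw [abs_of_nonpos h0, neg_div] at h1
      have h3 := hmvt (G a - 1) ⟨by linarith [hGa.1], by linarith [hGa.2]⟩ _ hmem (by linarith)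
      have h4 := hanti.antitone (show G a + ξ / ε ≤ G a - 1 by linarith)
      rw [hFG] at h3
      linarith [(abs_le.1 herr1).1]
    · rw [abs_of_nonneg h0] at h1
      have h3 := hmvt _ hmem (G a + 1) ⟨by linarith [hGa.1], by linarith [hGa.2]⟩ (by linarith)
      have h4 := hanti.antitone (show G a + 1 ≤ G a + ξ / ε by linarith)
      rw [hFG] at h3
      linarith [(abs_le.1 herr1).2]

end HalfLineHJ

namespace HalfLineHJ

variable {H F : ℝ → ℝ} {T : ℝ} {U : ℝ × ℝ → ℝ}

/-! ### Comparison with smooth barriers -/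

lemma exists_max_of_compact_superlevel {X : Type*} [TopologicalSpace X] {f : X → ℝ} {S K : Set X}
    (hK : IsCompact K) (hKS : K ⊆ S) (hf : UpperSemicontinuousOn f S) {z₀ : X} (hz₀ : z₀ ∈ S)
    (h : ∀ z ∈ S, f z₀ ≤ f z → z ∈ K) : ∃ z ∈ S, f z₀ ≤ f z ∧ ∀ w ∈ S, f w ≤ f z := by
  obtain ⟨z, hz, hmax⟩ := (hf.mono hKS).exists_isMaxOn ⟨z₀, h z₀ hz₀ le_rfl⟩ hK
  refine ⟨z, hKS hz, hmax (h z₀ hz₀ le_rfl), fun w hw => ?_⟩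
  rcases le_total (f z₀) (f w) with h1 | h1
  · exact hmax (h w hw h1)
  · exact h1.trans (hmax (h z₀ hz₀ le_rfl))

lemma hasDerivAt_div_sub {η T t : ℝ} (ht : t < T) :
    HasDerivAt (fun s => η / (T - s)) (η / (T - t) ^ 2) t := by
  have h := (hasDerivAt_const t η).div ((hasDerivAt_id' t).const_sub T) (by linarith)
  exact h.congr_deriv (by simp)

lemma continuousOn_div_sub {η T : ℝ} : ContinuousOn (fun t => η / (T - t)) (Iio T) :=
  continuousOn_const.div (by fun_prop) fun t ht => (sub_pos.2 ht).ne'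

lemma contDiffOn_div_sub {η T : ℝ} :
    ContDiffOn ℝ 1 (fun z : ℝ × ℝ => η / (T - z.1)) (openDomain T) :=
  contDiffOn_const.div (by fun_prop) fun _ hz => (sub_pos.2 hz.1.2).ne'

/-- A sub-solution of linear growth lying below a `C¹` function `g` with bounded derivative at time
`0` stays below `g + C₁ t` for some `C₁`. The gradient `2 α x` of the penalisation `α x²`
at a maximum point is bounded in terms of the linear growth only, so that `C₁` can be chosen larger
than `|H|` and `|F|` at all slopes that occur. -/
lemma IsViscositySubsolution.exists_le_add_mul (hU : IsViscositySubsolution H F T U)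
    (hH : Continuous H) (hF : Continuous F) (husc : UpperSemicontinuousOn U (domain T)) {B : ℝ}
    (hB : ∀ z ∈ domain T, U z ≤ B * (1 + z.2)) {g : ℝ → ℝ} {L : ℝ} (hL : 0 ≤ L)
    (hg : ContDiff ℝ 1 g) (hgL : ∀ x, |deriv g x| ≤ L) (h0 : ∀ x, 0 ≤ x → U (0, x) ≤ g x) :
    ∃ C₁, 0 ≤ C₁ ∧ ∀ z ∈ domain T, U z ≤ g z.2 + C₁ * z.1 := by
  set D := |B| + |g 0| + L with hD
  have hD0 : 0 ≤ D := by positivity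
  have hUg : ∀ z ∈ domain T, U z - g z.2 ≤ D * (1 + z.2) := by
    intro z hz
    have hx : 0 ≤ z.2 := hz.2
    have h1 : ‖g z.2 - g 0‖ ≤ L * ‖z.2 - 0‖ :=
      convex_univ.norm_image_sub_le_of_norm_deriv_le
        (fun x _ => hg.differentiable one_ne_zero x) (fun x _ => hgL x) (mem_univ _) (mem_univ _)
    rw [Real.norm_eq_abs, Real.norm_eq_abs, sub_zero, abs_of_nonneg hx] at h1
    have h2 := (abs_le.1 h1).1
    have h3 := neg_abs_le (g 0)
    have h4 := hB z hz
    have h5 : B * (1 + z.2) ≤ |B| * (1 + z.2) :=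
      mul_le_mul_of_nonneg_right (le_abs_self B) (by linarith)
    have h6 : 0 ≤ |g 0| * z.2 := by positivity
    rw [hD]
    linarith
  set R := L + (4 * D + 2) with hR
  obtain ⟨c₁, hc₁⟩ := (isCompact_Icc (a := -R) (b := R)).exists_bound_of_continuousOn
    hH.continuousOn
  obtain ⟨c₂, hc₂⟩ := (isCompact_Icc (a := -R) (b := R)).exists_bound_of_continuousOn
    hF.continuousOn
  set C₁ := |c₁| + |c₂| with hC₁
  have hC0 : 0 ≤ C₁ := by positivity
  refine ⟨C₁, hC0, fun z₁ hz₁ => ?_⟩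
  by_contra! hlt
  set m := U z₁ - (g z₁.2 + C₁ * z₁.1) with hm
  have hm0 : 0 < m := by linarith
  have ht₁ : 0 < T - z₁.1 := sub_pos.2 hz₁.1.2
  set η := m * (T - z₁.1) / 4 with hη
  have hη0 : 0 < η := by positivity
  set α := min 1 (m / (4 * (z₁.2 ^ 2 + 1))) with hα
  have hα0 : 0 < α := lt_min one_pos (by positivity)
  set φ : ℝ × ℝ → ℝ := fun z => g z.2 + C₁ * z.1 + η / (T - z.1) + α * z.2 ^ 2 with hφ
  have hval : m / 2 ≤ U z₁ - φ z₁ := by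
    have h1 : η / (T - z₁.1) = m / 4 := by rw [hη]; field_simp
    have h2 : α * z₁.2 ^ 2 ≤ m / 4 := by
      calc α * z₁.2 ^ 2 ≤ m / (4 * (z₁.2 ^ 2 + 1)) * (z₁.2 ^ 2 + 1) := by
            gcongr
            · exact min_le_right _ _
            · linarith
        _ = m / 4 := by field_simp
    simp only [hφ, h1]
    linarith
  have hsup : ∀ z ∈ domain T, U z₁ - φ z₁ ≤ U z - φ z →
      η / (T - z.1) + α * z.2 ^ 2 ≤ D * (1 + z.2) := by
    intro z hz h
    have h1 := hUg z hz
    have h2 : 0 ≤ C₁ * z.1 := mul_nonneg hC0 hz.1.1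
    simp only [hφ] at h hval
    linarith
  have hαx : ∀ z ∈ domain T, U z₁ - φ z₁ ≤ U z - φ z → α * z.2 ≤ 2 * D + 1 := by
    intro z hz h
    have h1 := hsup z hz h
    have hx : 0 ≤ z.2 := hz.2
    have h2 : 0 < η / (T - z.1) := div_pos hη0 (sub_pos.2 hz.1.2)
    rcases le_total z.2 1 with h3 | h3
    · have : α * z.2 ≤ 1 * 1 := mul_le_mul (min_le_left _ _) h3 hx zero_le_one
      linarith
    · have h4 : α * z.2 * z.2 ≤ 2 * D * z.2 := by nlinarith
      have := le_of_mul_le_mul_right h4 (by linarith)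
      linarith
  set X := (2 * D + 1) / α with hX
  have hX0 : 0 ≤ X := by positivity
  set Q := D * (1 + X) + 1 with hQ
  have hQ0 : 0 < Q := by positivity
  have hκ : 0 < η / Q := by positivity
  have hφc : ContinuousOn φ (domain T) := by
    refine ContinuousOn.add (ContinuousOn.add (Continuous.continuousOn ?_) ?_)
      (Continuous.continuousOn (by fun_prop))
    · exact (hg.continuous.comp continuous_snd).add (by fun_prop)
    · exact continuousOn_div_sub.comp continuousOn_fst fun z hz => hz.1.2
  obtain ⟨z, hz, hz₁z, hmax⟩ := exists_max_of_compact_superlevel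
    (f := fun z => U z - φ z) (S := domain T)
    (K := Icc 0 (T - η / Q) ×ˢ Icc 0 X) (isCompact_Icc.prod isCompact_Icc)
    (fun z hz => ⟨⟨hz.1.1, by linarith [hz.1.2]⟩, hz.2.1⟩)
    (by
      simp only [sub_eq_add_neg]
      exact husc.add hφc.neg.upperSemicontinuousOn) hz₁
    (fun z hz h => by
      have hx : z.2 ≤ X := by
        rw [hX, le_div_iff₀ hα0, mul_comm]; exact hαx z hz h
      refine ⟨⟨hz.1.1, ?_⟩, hz.2, hx⟩
      have h1 : η / (T - z.1) ≤ Q := by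
        have h2 := hsup z hz h
        have h3 : 0 ≤ α * z.2 ^ 2 := by positivity
        have h4 : D * (1 + z.2) ≤ D * (1 + X) := by gcongr
        linarith
      rw [div_le_iff₀ (sub_pos.2 hz.1.2)] at h1
      have : η / Q ≤ T - z.1 := by rwa [div_le_iff₀ hQ0, mul_comm]
      linarith)
  have htT : z.1 < T := hz.1.2
  -- The maximum point is not at time `0`, where `U ≤ g`.
  have ht : 0 < z.1 := by
    refine lt_of_le_of_ne hz.1.1 fun h => ?_
    have h1 := h0 z.2 hz.2
    have h2 : 0 < η / (T - z.1) := div_pos hη0 (sub_pos.2 htT)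
    have h3 : 0 ≤ α * z.2 ^ 2 := by positivity
    have h4 : U z = U (0, z.2) := by rw [h]
    simp only [hφ] at hz₁z hval
    rw [h4, ← h] at hz₁z
    rw [← h] at h2
    linarith
  have hφ1 : ContDiffOn ℝ 1 φ (openDomain T) := by
    refine ContDiffOn.add (ContDiffOn.add (ContDiff.contDiffOn ?_) contDiffOn_div_sub)
      (ContDiff.contDiffOn (by fun_prop))
    exact (hg.comp contDiff_snd).add (by fun_prop)
  have hpα : |2 * α * z.2| ≤ 4 * D + 2 := by
    have hx : 0 ≤ z.2 := hz.2
    rw [abs_of_nonneg (by positivity)]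
    linarith [hαx z hz hz₁z]
  have hp : deriv g z.2 + 2 * α * z.2 ∈ Icc (-R) R :=
    abs_le.1 ((abs_add_le _ _).trans (add_le_add (hgL _) hpα))
  have hpos : 0 < η / (T - z.1) ^ 2 := by
    have := sub_pos.2 htT
    positivity
  have key := hU φ hφ1 z ⟨⟨ht, htT⟩, hz.2⟩ (fun w hw => hmax w (openDomain_subset_domain hw))
    (C₁ + η / (T - z.1) ^ 2) (deriv g z.2 + 2 * α * z.2)
    (by
      have h := ((((hasDerivAt_id' z.1).const_mul C₁).const_add (g z.2)).add
        (hasDerivAt_div_sub (η := η) htT)).add_const (α * z.2 ^ 2)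
      exact h.congr_deriv (by simp))
    (by
      have h := ((((hg.differentiable one_ne_zero) z.2).hasDerivAt.add_const (C₁ * z.1)).add_const
        (η / (T - z.1))).add (((hasDerivAt_id' z.2).pow 2).const_mul α)
      exact h.congr_deriv (by simp; ring))
  have hc₁' := (abs_le.1 ((hc₁ _ hp).trans (le_abs_self c₁))).1
  have hc₂' := (abs_le.1 ((hc₂ _ hp).trans (le_abs_self c₂))).1
  have := abs_nonneg c₁
  have := abs_nonneg c₂
  rcases key with h | ⟨-, h⟩ <;> linarith

/-- The initial datum is attained uniformly in space. -/
lemma IsViscositySubsolution.exists_le_initial (hU : IsViscositySubsolution H F T U)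
    (hH : Continuous H) (hF : Continuous F) (husc : UpperSemicontinuousOn U (domain T)) {B : ℝ}
    (hB : ∀ z ∈ domain T, U z ≤ B * (1 + z.2)) {u₀ : ℝ → ℝ}
    (hu₀ : UniformContinuousOn u₀ (Ici 0)) (h0 : ∀ x, 0 ≤ x → U (0, x) ≤ u₀ x) {e : ℝ}
    (he : 0 < e) :
    ∃ C₁, 0 ≤ C₁ ∧ ∀ z ∈ domain T, U z ≤ u₀ z.2 + e + C₁ * z.1 := by
  obtain ⟨g, L, hL, hg, hgL, hug⟩ := exists_contDiff_approx hu₀ (half_pos he)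
  obtain ⟨C₁, hC₁, h⟩ := hU.exists_le_add_mul hH hF husc hB (g := fun x => g x + e / 2) hL
    (by fun_prop) (by simpa using hgL)
    (fun x hx => by linarith [h0 x hx, (abs_le.1 (hug x hx)).2])
  refine ⟨C₁, hC₁, fun z hz => ?_⟩
  linarith [h z hz, (abs_le.1 (hug z.2 hz.2)).1]

lemma exists_abs_sub_le_linear {u₀ : ℝ → ℝ} (hu₀ : UniformContinuousOn u₀ (Ici 0)) :
    ∃ L, 0 ≤ L ∧ ∀ x y, 0 ≤ x → 0 ≤ y → |u₀ x - u₀ y| ≤ 2 + L * |x - y| := by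
  obtain ⟨g, L, hL, hg, hgL, hug⟩ := exists_contDiff_approx hu₀ one_pos
  refine ⟨L, hL, fun x y hx hy => ?_⟩
  have h1 : ‖g x - g y‖ ≤ L * ‖x - y‖ :=
    convex_univ.norm_image_sub_le_of_norm_deriv_le
      (fun x _ => hg.differentiable one_ne_zero x) (fun x _ => hgL x) (mem_univ _) (mem_univ _)
  have h2 := abs_le.1 h1
  have h3 := abs_le.1 (hug x hx)
  have h4 := abs_le.1 (hug y hy)
  simp only [Real.norm_eq_abs] at h2
  exact abs_le.2 ⟨by linarith, by linarith⟩

end HalfLineHJ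

namespace HalfLineHJ

variable {H F G : ℝ → ℝ} {T δ ε η α : ℝ} {U W : ℝ × ℝ → ℝ}

/-! ### The doubling penalisation -/

/-- The penalisation `ψ(τ, ξ) = τ² / (2δ) + G(τ/δ) ξ + ξ² / (2ε)` of the doubled variables, where
`τ = t - s` and `ξ = x - y`. With `G a = F⁻¹(-a)`, the middle term tilts the usual
quadratic penalisation so that the boundary equation `ψ_τ + F(ψ_ξ) = 0` holds on `ξ = 0`. -/
noncomputable def penalty (G : ℝ → ℝ) (δ ε τ ξ : ℝ) : ℝ :=
  τ ^ 2 / (2 * δ) + G (τ / δ) * ξ + ξ ^ 2 / (2 * ε)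

lemma hasDerivAt_penalty_left (hG : ContDiff ℝ 1 G) (δ ε τ ξ : ℝ) :
    HasDerivAt (fun τ => penalty G δ ε τ ξ) (τ / δ + deriv G (τ / δ) * ξ / δ) τ := by
  have h1 := ((hasDerivAt_id' τ).pow 2).div_const (2 * δ)
  have h2 := (((hG.differentiable one_ne_zero (τ / δ)).hasDerivAt.comp τ
    ((hasDerivAt_id' τ).div_const δ)).mul_const ξ)
  refine ((h1.add h2).add_const (ξ ^ 2 / (2 * ε))).congr_deriv ?_
  simp
  ring

lemma hasDerivAt_penalty_right (G : ℝ → ℝ) (δ ε τ ξ : ℝ) :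
    HasDerivAt (fun ξ => penalty G δ ε τ ξ) (G (τ / δ) + ξ / ε) ξ := by
  have h1 := ((hasDerivAt_id' ξ).pow 2).div_const (2 * ε)
  have h2 := ((hasDerivAt_id' ξ).const_mul (G (τ / δ))).const_add (τ ^ 2 / (2 * δ))
  refine (h2.add h1).congr_deriv ?_
  simp
  ring

lemma contDiff_penalty (hG : ContDiff ℝ 1 G) (δ ε : ℝ) :
    ContDiff ℝ 1 (fun q : ℝ × ℝ => penalty G δ ε q.1 q.2) := by
  unfold penalty
  have : ContDiff ℝ 1 fun q : ℝ × ℝ => G (q.1 / δ) := hG.comp (by fun_prop)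
  fun_prop

/-- The function maximised in the doubling of variables. -/
noncomputable def doubled (G : ℝ → ℝ) (T δ ε η α : ℝ) (U W : ℝ × ℝ → ℝ)
    (q : (ℝ × ℝ) × (ℝ × ℝ)) : ℝ :=
  U q.1 + W q.2 - (penalty G δ ε (q.1.1 - q.2.1) (q.1.2 - q.2.2) + η / (T - q.1.1)
    + η / (T - q.2.1) + α * q.1.2 ^ 2)

lemma upperSemicontinuousOn_doubled (hG : ContDiff ℝ 1 G)
    (hU : UpperSemicontinuousOn U (domain T)) (hW : UpperSemicontinuousOn W (domain T)) :
    UpperSemicontinuousOn (doubled G T δ ε η α U W) (domain T ×ˢ domain T) := by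
  have h1 : UpperSemicontinuousOn (fun q : (ℝ × ℝ) × (ℝ × ℝ) => U q.1) (domain T ×ˢ domain T) :=
    hU.comp continuousOn_fst fun q hq => hq.1
  have h2 : UpperSemicontinuousOn (fun q : (ℝ × ℝ) × (ℝ × ℝ) => W q.2) (domain T ×ˢ domain T) :=
    hW.comp continuousOn_snd fun q hq => hq.2
  have h3 : ContinuousOn (fun q : (ℝ × ℝ) × (ℝ × ℝ) =>
      penalty G δ ε (q.1.1 - q.2.1) (q.1.2 - q.2.2) + η / (T - q.1.1)
      + η / (T - q.2.1) + α * q.1.2 ^ 2) (domain T ×ˢ domain T) := by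
    refine ContinuousOn.add (ContinuousOn.add (ContinuousOn.add (Continuous.continuousOn ?_) ?_) ?_)
      (Continuous.continuousOn (by fun_prop))
    · exact (contDiff_penalty hG δ ε).continuous.comp (by fun_prop :
        Continuous fun q : (ℝ × ℝ) × (ℝ × ℝ) => (q.1.1 - q.2.1, q.1.2 - q.2.2))
    · exact continuousOn_div_sub.comp (by fun_prop) fun q hq => hq.1.1.2
    · exact continuousOn_div_sub.comp (by fun_prop) fun q hq => hq.2.1.2
  unfold doubled
  simp only [sub_eq_add_neg _ (_ + _)]
  exact (h1.add h2).add h3.neg.upperSemicontinuousOn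

/-- At a maximum point of the doubled function the sign condition on `ψ_τ + F(ψ_ξ)` rules out the
boundary inequality for `F`, for both sub-solutions, so that the two viscosity inequalities involve
`H` only and may be subtracted. -/
lemma viscosity_inequality_of_max (hG : ContDiff ℝ 1 G) (hU : IsViscositySubsolution H F T U)
    (hW : IsViscositySubsolution (fun p => -H (-p)) (fun p => -F (-p)) T W) (hη : 0 < η)
    {t x s y : ℝ} (hz : (t, x) ∈ openDomain T) (hw : (s, y) ∈ openDomain T)
    (hmax : ∀ q ∈ domain T ×ˢ domain T,
      doubled G T δ ε η α U W q ≤ doubled G T δ ε η α U W ((t, x), (s, y)))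
    (hneg : x - y ≤ 0 → 0 ≤ (t - s) / δ + deriv G ((t - s) / δ) * (x - y) / δ
      + F (G ((t - s) / δ) + (x - y) / ε))
    (hpos : 0 ≤ x - y → (t - s) / δ + deriv G ((t - s) / δ) * (x - y) / δ
      + F (G ((t - s) / δ) + (x - y) / ε) ≤ 0) :
    η / (T - t) ^ 2 + η / (T - s) ^ 2 ≤ H (G ((t - s) / δ) + (x - y) / ε)
      - H (G ((t - s) / δ) + (x - y) / ε + 2 * α * x) := by
  have htT : t < T := hz.1.2
  have hsT : s < T := hw.1.2
  have hx : 0 ≤ x := hz.2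
  have hy : 0 ≤ y := hw.2
  have hηt : 0 < η / (T - t) ^ 2 := by have := sub_pos.2 htT; positivity
  have hηs : 0 < η / (T - s) ^ 2 := by have := sub_pos.2 hsT; positivity
  have hψ := contDiff_penalty hG δ ε
  have hUz := hU (fun z => penalty G δ ε (z.1 - s) (z.2 - y) + η / (T - z.1) + α * z.2 ^ 2)
    (by
      refine ContDiffOn.add (ContDiffOn.add (ContDiff.contDiffOn ?_) contDiffOn_div_sub)
        (ContDiff.contDiffOn (by fun_prop))
      exact hψ.comp (by fun_prop : ContDiff ℝ 1 fun z : ℝ × ℝ => (z.1 - s, z.2 - y)))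
    (t, x) hz
    (fun z' hz' => by
      have := hmax (z', (s, y)) ⟨openDomain_subset_domain hz', openDomain_subset_domain hw⟩
      simp only [doubled] at this
      linarith)
    ((t - s) / δ + deriv G ((t - s) / δ) * (x - y) / δ + η / (T - t) ^ 2)
    (G ((t - s) / δ) + (x - y) / ε + 2 * α * x)
    (((((hasDerivAt_penalty_left hG δ ε (t - s) (x - y)).comp_sub_const t s).add
      (hasDerivAt_div_sub htT)).add_const (α * x ^ 2)))
    (by
      have h := (((hasDerivAt_penalty_right G δ ε (t - s) (x - y)).comp_sub_const x y).add_const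
        (η / (T - t))).add (((hasDerivAt_id' x).pow 2).const_mul α)
      exact h.congr_deriv (by simp; ring))
  have hWw := hW (fun w => penalty G δ ε (t - w.1) (x - w.2) + η / (T - w.1))
    (by
      refine ContDiffOn.add (ContDiff.contDiffOn ?_) contDiffOn_div_sub
      exact hψ.comp (by fun_prop : ContDiff ℝ 1 fun w : ℝ × ℝ => (t - w.1, x - w.2)))
    (s, y) hw
    (fun w' hw' => by
      have := hmax ((t, x), w') ⟨openDomain_subset_domain hz, openDomain_subset_domain hw'⟩
      simp only [doubled] at this
      linarith)
    (-((t - s) / δ + deriv G ((t - s) / δ) * (x - y) / δ) + η / (T - s) ^ 2)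
    (-(G ((t - s) / δ) + (x - y) / ε))
    (((hasDerivAt_penalty_left hG δ ε (t - s) (x - y)).comp_const_sub t s).add
      (hasDerivAt_div_sub hsT))
    (((hasDerivAt_penalty_right G δ ε (t - s) (x - y)).comp_const_sub x y).add_const (η / (T - s)))
  simp only [neg_neg] at hWw
  have hUz' : (t - s) / δ + deriv G ((t - s) / δ) * (x - y) / δ + η / (T - t) ^ 2
      + H (G ((t - s) / δ) + (x - y) / ε + 2 * α * x) ≤ 0 := by
    rcases hUz with h | ⟨h0, h⟩
    · exact h
    · obtain rfl : x = 0 := h0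
      rw [mul_zero, add_zero] at h
      linarith [hneg (by linarith)]
  have hWw' : -((t - s) / δ + deriv G ((t - s) / δ) * (x - y) / δ) + η / (T - s) ^ 2
      - H (G ((t - s) / δ) + (x - y) / ε) ≤ 0 := by
    rcases hWw with h | ⟨h0, h⟩
    · linarith
    · obtain rfl : y = 0 := h0
      linarith [hpos (by linarith)]
  linarith

/-! ### Comparison -/

set_option maxHeartbeats 1000000 in
/-- The comparison principle for a sub-solution `U` and, with `W = -V`, a super-solution `V`, under
linear control of `U(t, x) - V(s, y)` in `|x - y|` and with uniformly attained initial data. -/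
theorem add_nonpos_of_isViscositySubsolution {u₀ : ℝ → ℝ} (hH : Continuous H)
    (hF : ContDiff ℝ 1 F) (hF' : ∀ p, deriv F p < 0)
    (hFbot : Tendsto F atBot atTop) (hFtop : Tendsto F atTop atBot)
    (hu₀ : UniformContinuousOn u₀ (Ici 0))
    (hU : IsViscositySubsolution H F T U)
    (hW : IsViscositySubsolution (fun p => -H (-p)) (fun p => -F (-p)) T W)
    (hUc : UpperSemicontinuousOn U (domain T)) (hWc : UpperSemicontinuousOn W (domain T))
    {L K : ℝ} (hL : 0 ≤ L) (hK : 0 ≤ K)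
    (hlin : ∀ z ∈ domain T, ∀ w ∈ domain T, U z + W w ≤ L * |z.2 - w.2| + K)
    (hinit : ∀ e > 0, ∃ C₁, 0 ≤ C₁ ∧ (∀ z ∈ domain T, U z ≤ u₀ z.2 + e + C₁ * z.1) ∧
      ∀ z ∈ domain T, W z ≤ -u₀ z.2 + e + C₁ * z.1) :
    ∀ z ∈ domain T, U z + W z ≤ 0 := by
  intro z₁ hz₁
  by_contra! hM
  set M := U z₁ + W z₁ with hMdef
  have hT : 0 < T := hz₁.1.1.trans_lt hz₁.1.2
  have ht₁ : 0 < T - z₁.1 := sub_pos.2 hz₁.1.2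
  obtain ⟨G, hG, hFG⟩ := exists_contDiff_section hF hF' hFbot hFtop
  obtain ⟨C₁, hC₁, hUi, hWi⟩ := hinit (M / 16) (by positivity)
  obtain ⟨d, hd, hdu⟩ := Metric.uniformContinuousOn_iff.1 hu₀ (M / 16) (by positivity)
  -- The parameters are fixed in the order `δ`, `ε`, `α`. First `δ`, which forces `|τ| ≤ σ`.
  set σ := M / (16 * (C₁ + 1)) with hσ
  have hσ0 : 0 < σ := by positivity
  set δ := σ ^ 2 / (2 * (K + 1)) with hδ
  have hδ0 : 0 < δ := by positivity
  obtain ⟨Gb, hGb⟩ := (isCompact_Icc (a := -(T / δ)) (b := T / δ)).exists_bound_of_continuousOn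
    hG.continuous.continuousOn
  have hGb0 : 0 ≤ Gb := (norm_nonneg _).trans (hGb 0 ⟨by simp; positivity, by positivity⟩)
  obtain ⟨κ, hκ0, hκ⟩ := exists_boundary_sign hF hF' hG hFG (T / δ) hδ0
  set A := L + Gb with hA
  have hA0 : 0 ≤ A := by positivity
  -- Then `ε`, which forces `|ξ| ≤ r`.
  set r := min κ (min (d / 2) (min 1 (M / 16) / (A + 1))) with hr
  have hr0 : 0 < r := by positivity
  have hrκ : r ≤ κ := min_le_left _ _
  have hrd : r < d := ((min_le_right _ _).trans (min_le_left _ _)).trans_lt (by linarith)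
  have hAr' : A * r ≤ min 1 (M / 16) := by
    have h1 : r ≤ min 1 (M / 16) / (A + 1) := (min_le_right _ _).trans (min_le_right _ _)
    rw [le_div_iff₀ (by positivity)] at h1
    linarith
  have hAr1 : A * r ≤ 1 := hAr'.trans (min_le_left _ _)
  have hArM : A * r ≤ M / 16 := hAr'.trans (min_le_right _ _)
  set ε := min κ (r / (2 * (A + K / r) + 1)) with hε
  have hε0 : 0 < ε := by positivity
  have hεr : 2 * ε * (A + K / r) < r := by
    have h1 : ε ≤ r / (2 * (A + K / r) + 1) := min_le_right _ _
    rw [le_div_iff₀ (by positivity)] at h1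
    linarith
  set η := M * (T - z₁.1) / 16 with hη
  have hη0 : 0 < η := by positivity
  -- Finally `α`, which makes the gradient `2 α x` of the penalisation at infinity at most `θ`.
  set R := Gb + r / ε with hR
  have hR0 : 0 ≤ R := by positivity
  obtain ⟨θ₀, hθ₀, hHθ⟩ := Metric.uniformContinuousOn_iff.1
    ((isCompact_Icc (a := -(R + 1)) (b := R + 1)).uniformContinuousOn_of_continuous
      hH.continuousOn) (2 * (η / T ^ 2)) (by positivity)
  set θ := min (θ₀ / 2) 1 with hθ
  have hθ0 : 0 < θ := by positivity
  set α := min (M / (8 * (z₁.2 ^ 2 + 1))) (θ ^ 2 / (4 * (K + 1))) with hα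
  have hα0 : 0 < α := by positivity
  set Φ := doubled G T δ ε η α U W with hΦ
  have hval : M / 2 ≤ Φ (z₁, z₁) := by
    have h1 : η / (T - z₁.1) = M / 16 := by rw [hη]; field_simp
    have h2 : α * z₁.2 ^ 2 ≤ M / 8 := by
      calc α * z₁.2 ^ 2 ≤ M / (8 * (z₁.2 ^ 2 + 1)) * (z₁.2 ^ 2 + 1) := by
            gcongr
            · exact min_le_left _ _
            · linarith
        _ = M / 8 := by field_simp
    simp only [hΦ, doubled, penalty, sub_self, h1]
    norm_num
    linarith
  have hτT : ∀ q ∈ domain T ×ˢ domain T, |(q.1.1 - q.2.1) / δ| ≤ T / δ := by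
    intro q hq
    rw [abs_div, abs_of_pos hδ0]
    gcongr
    have h1 := hq.1.1
    have h2 := hq.2.1
    exact abs_le.2 ⟨by linarith [h1.1, h2.2], by linarith [h1.2, h2.1]⟩
  have hGξ : ∀ q ∈ domain T ×ˢ domain T,
      |G ((q.1.1 - q.2.1) / δ) * (q.1.2 - q.2.2)| ≤ Gb * |q.1.2 - q.2.2| := by
    intro q hq
    rw [abs_mul]
    gcongr
    exact hGb _ (abs_le.1 (hτT q hq))
  have hsum : ∀ q ∈ domain T ×ˢ domain T, Φ (z₁, z₁) ≤ Φ q →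
      (q.1.1 - q.2.1) ^ 2 / (2 * δ) + (q.1.2 - q.2.2) ^ 2 / (2 * ε) + η / (T - q.1.1)
        + η / (T - q.2.1) + α * q.1.2 ^ 2 ≤ A * |q.1.2 - q.2.2| + K := by
    intro q hq h
    have h1 := hlin q.1 hq.1 q.2 hq.2
    have h2 := (abs_le.1 (hGξ q hq)).1
    have h3 : M / 2 ≤ Φ q := hval.trans h
    simp only [hΦ, doubled, penalty] at h3
    rw [hA]
    linarith
  have hηq : ∀ q ∈ domain T ×ˢ domain T, 0 < η / (T - q.1.1) ∧ 0 < η / (T - q.2.1) :=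
    fun q hq => ⟨div_pos hη0 (sub_pos.2 hq.1.1.2), div_pos hη0 (sub_pos.2 hq.2.1.2)⟩
  have hξ : ∀ q ∈ domain T ×ˢ domain T, Φ (z₁, z₁) ≤ Φ q → |q.1.2 - q.2.2| ≤ r := by
    intro q hq h
    by_contra! hlt
    have h1 := hsum q hq h
    obtain ⟨h2, h3⟩ := hηq q hq
    have h4 : 0 ≤ (q.1.1 - q.2.1) ^ 2 / (2 * δ) := by positivity
    have h5 : 0 ≤ α * q.1.2 ^ 2 := by positivity
    have h6 : (q.1.2 - q.2.2) ^ 2 / (2 * ε) ≤ A * |q.1.2 - q.2.2| + K := by linarith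
    have h7 : K ≤ K / r * |q.1.2 - q.2.2| := by
      calc K = K / r * r := by field_simp
        _ ≤ _ := by gcongr
    rw [div_le_iff₀ (by positivity), ← sq_abs] at h6
    have h8 : |q.1.2 - q.2.2| * |q.1.2 - q.2.2|
        ≤ 2 * ε * (A + K / r) * |q.1.2 - q.2.2| := by
      calc |q.1.2 - q.2.2| * |q.1.2 - q.2.2| = |q.1.2 - q.2.2| ^ 2 := by ring
        _ ≤ (A * |q.1.2 - q.2.2| + K) * (2 * ε) := h6
        _ ≤ (A * |q.1.2 - q.2.2| + K / r * |q.1.2 - q.2.2|) * (2 * ε) := by gcongr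
        _ = _ := by ring
    have h9 := le_of_mul_le_mul_right h8 (hr0.trans hlt)
    linarith
  have hsum' : ∀ q ∈ domain T ×ˢ domain T, Φ (z₁, z₁) ≤ Φ q →
      (q.1.1 - q.2.1) ^ 2 / (2 * δ) + (q.1.2 - q.2.2) ^ 2 / (2 * ε) + η / (T - q.1.1)
        + η / (T - q.2.1) + α * q.1.2 ^ 2 ≤ K + 1 := by
    intro q hq h
    have h1 : A * |q.1.2 - q.2.2| ≤ A * r := mul_le_mul_of_nonneg_left (hξ q hq h) hA0
    linarith [hsum q hq h]
  have hfar : ∀ q ∈ domain T ×ˢ domain T, Φ (z₁, z₁) ≤ Φ q →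
      η / (T - q.1.1) ≤ K + 1 ∧ η / (T - q.2.1) ≤ K + 1 ∧ α * q.1.2 ^ 2 ≤ K + 1 ∧
        (q.1.1 - q.2.1) ^ 2 / (2 * δ) ≤ K + 1 := by
    intro q hq h
    have h1 := hsum' q hq h
    obtain ⟨h2, h3⟩ := hηq q hq
    have h4 : 0 ≤ (q.1.1 - q.2.1) ^ 2 / (2 * δ) := by positivity
    have h5 : 0 ≤ α * q.1.2 ^ 2 := by positivity
    have h6 : 0 ≤ (q.1.2 - q.2.2) ^ 2 / (2 * ε) := by positivity
    refine ⟨?_, ?_, ?_, ?_⟩ <;> linarith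
  set X := (K + 1) / α + 1 with hX
  have htime : ∀ t : ℝ, t < T → η / (T - t) ≤ K + 1 → t ≤ T - η / (K + 1) := by
    intro t ht h
    rw [div_le_iff₀ (sub_pos.2 ht)] at h
    have : η / (K + 1) ≤ T - t := by rwa [div_le_iff₀ (by positivity), mul_comm]
    linarith
  have hηK : 0 < η / (K + 1) := by positivity
  obtain ⟨⟨⟨t, x⟩, ⟨s, y⟩⟩, hq, hge, hmax⟩ := exists_max_of_compact_superlevel
    (f := Φ) (S := domain T ×ˢ domain T) (z₀ := (z₁, z₁))
    (K := (Icc 0 (T - η / (K + 1)) ×ˢ Icc 0 X) ×ˢ (Icc 0 (T - η / (K + 1)) ×ˢ Icc 0 (X + r)))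
    ((isCompact_Icc.prod isCompact_Icc).prod (isCompact_Icc.prod isCompact_Icc))
    (fun q hq => ⟨⟨⟨hq.1.1.1, by linarith [hq.1.1.2]⟩, hq.1.2.1⟩,
      ⟨hq.2.1.1, by linarith [hq.2.1.2]⟩, hq.2.2.1⟩)
    (upperSemicontinuousOn_doubled hG hUc hWc) ⟨hz₁, hz₁⟩
    (fun q hq h => by
      obtain ⟨h1, h2, h3, -⟩ := hfar q hq h
      have hx : q.1.2 ≤ X := by
        rcases le_total q.1.2 1 with h4 | h4
        · have : 0 ≤ (K + 1) / α := by positivity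
          linarith
        · have h5 : α * q.1.2 ≤ α * q.1.2 ^ 2 := by
            gcongr
            nlinarith
          have : q.1.2 ≤ (K + 1) / α := by
            rw [le_div_iff₀ hα0, mul_comm]
            linarith
          linarith
      have hy := (abs_le.1 (hξ q hq h)).1
      exact ⟨⟨⟨hq.1.1.1, htime _ hq.1.1.2 h1⟩, hq.1.2, hx⟩,
        ⟨hq.2.1.1, htime _ hq.2.1.2 h2⟩, hq.2.2, by linarith⟩)
  have hξr : |x - y| ≤ r := hξ _ hq hge
  have hx0 : 0 ≤ x := hq.1.2
  have hy0 : 0 ≤ y := hq.2.2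
  have ht0 : 0 ≤ t := hq.1.1.1
  have hs0 : 0 ≤ s := hq.2.1.1
  have htT : t < T := hq.1.1.2
  have hsT : s < T := hq.2.1.2
  obtain ⟨-, -, hαx, hτ⟩ := hfar _ hq hge
  have hτσ : |t - s| ≤ σ := by
    refine abs_le_of_sq_le_sq ?_ hσ0.le
    rw [div_le_iff₀ (by positivity)] at hτ
    refine hτ.trans (le_of_eq ?_)
    rw [hδ]
    field_simp
  -- At an initial time the value would be smaller than `M / 2`.
  have hsmall : C₁ * (t + s) ≤ M / 16 → False := by
    intro h
    have h1 := hUi (t, x) hq.1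
    have h2 := hWi (s, y) hq.2
    have h3 : u₀ x - u₀ y < M / 16 :=
      (abs_lt.1 (hdu x hx0 y hy0 (hξr.trans_lt hrd))).2
    have h4 := (abs_le.1 (hGξ _ hq)).1
    have h5 : Gb * |x - y| ≤ A * r := by
      gcongr
      linarith
    have h6 := hval.trans hge
    obtain ⟨h7, h8⟩ := hηq _ hq
    have h9 : 0 ≤ (t - s) ^ 2 / (2 * δ) := by positivity
    have h10 : 0 ≤ (x - y) ^ 2 / (2 * ε) := by positivity
    have h11 : 0 ≤ α * x ^ 2 := by positivity
    simp only [hΦ, doubled, penalty] at h1 h2 h4 h6 h7 h8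
    linarith
  have hCσ : C₁ * σ ≤ M / 16 := by
    have : (C₁ + 1) * σ = M / 16 := by rw [hσ]; field_simp
    linarith
  have ht : 0 < t := by
    refine lt_of_le_of_ne ht0 fun h => hsmall ((mul_le_mul_of_nonneg_left ?_ hC₁).trans hCσ)
    linarith [(abs_le.1 hτσ).1]
  have hs : 0 < s := by
    refine lt_of_le_of_ne hs0 fun h => hsmall ((mul_le_mul_of_nonneg_left ?_ hC₁).trans hCσ)
    linarith [(abs_le.1 hτσ).2]
  have hsign := hκ ε hε0 (min_le_left _ _) _ (x - y) (hτT _ hq) (hξr.trans hrκ)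
  have key := viscosity_inequality_of_max hG hU hW hη0 ⟨⟨ht, htT⟩, hx0⟩ ⟨⟨hs, hsT⟩, hy0⟩
    hmax hsign.1 hsign.2
  set p := G ((t - s) / δ) + (x - y) / ε with hp
  have hpR : |p| ≤ R := by
    refine (abs_add_le _ _).trans (add_le_add (hGb _ (abs_le.1 (hτT _ hq))) ?_)
    rw [abs_div, abs_of_pos hε0]
    gcongr
  have hαθ : |2 * α * x| ≤ θ := by
    refine abs_le_of_sq_le_sq ?_ hθ0.le
    have h1 : α ≤ θ ^ 2 / (4 * (K + 1)) := min_le_right _ _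
    rw [le_div_iff₀ (by positivity)] at h1
    have h2 : α * (α * x ^ 2) ≤ α * (K + 1) := mul_le_mul_of_nonneg_left hαx hα0.le
    linarith
  have hθ1 : θ ≤ 1 := min_le_right _ _
  have hH' := hHθ p ⟨by linarith [(abs_le.1 hpR).1], by linarith [(abs_le.1 hpR).2]⟩
    (p + 2 * α * x)
    ⟨by linarith [(abs_le.1 hpR).1, (abs_le.1 hαθ).1],
      by linarith [(abs_le.1 hpR).2, (abs_le.1 hαθ).2]⟩
    (by
      rw [dist_comm, Real.dist_eq, add_sub_cancel_left]
      exact hαθ.trans_lt ((min_le_left _ _).trans_lt (by linarith)))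
  have h1 := (abs_lt.1 hH').2
  have hηT : ∀ t : ℝ, 0 < t → t < T → η / T ^ 2 ≤ η / (T - t) ^ 2 := by
    intro t h0 hT
    have := sub_pos.2 hT
    gcongr
    linarith
  linarith [hηT t ht htT, hηT s hs hsT]

end HalfLineHJ

namespace HalfLineHJ

/-! ### Back to relaxed solutions -/

/-- The facts about the envelope of a relaxed sub-solution of linear growth on which the comparison
argument rests. -/
lemma IsRelaxedSubsolution.realEnvelope_spec {H F u₀ : ℝ → ℝ} {T C : ℝ} {u : ℝ × ℝ → ℝ}
    (hu : IsRelaxedSubsolution H F u₀ T u) (hH : Continuous H) (hF : Continuous F)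
    (hu₀ : UniformContinuousOn u₀ (Ici 0))
    (hub : ∀ t x : ℝ, 0 < t → t < T → 0 ≤ x → u (t, x) ≤ C * (1 + x)) :
    IsViscositySubsolution H F T (realEnvelope T u) ∧
    UpperSemicontinuousOn (realEnvelope T u) (domain T) ∧
    (∀ z ∈ domain T, u z ≤ realEnvelope T u z) ∧
    ∀ e > 0, ∃ C₁, 0 ≤ C₁ ∧ ∀ z ∈ domain T, realEnvelope T u z ≤ u₀ z.2 + e + C₁ * z.1 := by
  have hfin : ∀ z ∈ domain T, (realEnvelope T u z : EReal) = upperEnvelope T u z :=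
    fun z hz => coe_realEnvelope hub hu.initial hz
  have hsub := hu.isViscositySubsolution hfin
  have husc := upperSemicontinuousOn_realEnvelope hfin
  have h0 : ∀ z ∈ domain T, z.1 = 0 → realEnvelope T u z ≤ u₀ z.2 := by
    rintro ⟨t, x⟩ hz rfl
    rw [← EReal.coe_le_coe_iff, hfin _ hz]
    exact hu.initial x hz.2
  obtain ⟨L, hL, hLu⟩ := exists_abs_sub_le_linear hu₀
  set B := |C| + |u₀ 0| + 2 + L with hB
  have hlin : ∀ z ∈ domain T, realEnvelope T u z ≤ B * (1 + z.2) := by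
    rintro ⟨t, x⟩ hz
    have hx : 0 ≤ x := hz.2
    rcases hz.1.1.eq_or_lt with h | h
    · have h1 := h0 _ hz h.symm
      have h2 := (abs_le.1 (hLu x 0 hx le_rfl)).2
      rw [sub_zero, abs_of_nonneg hx] at h2
      have h3 := le_abs_self (u₀ 0)
      have h4 : 0 ≤ (|C| + |u₀ 0| + 2) * x := by positivity
      have h5 := abs_nonneg C
      simp only [hB] at h1 ⊢
      linarith
    · have h1 : realEnvelope T u (t, x) ≤ C * (1 + x) := by
        rw [← EReal.coe_le_coe_iff, hfin _ hz]
        exact upperEnvelope_le_linear hub h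
      refine h1.trans (mul_le_mul_of_nonneg_right ?_ (by linarith))
      linarith [le_abs_self C, abs_nonneg (u₀ 0)]
  refine ⟨hsub, husc, fun z hz => ?_, fun e he => ?_⟩
  · rw [← EReal.coe_le_coe_iff, hfin z hz]
    exact le_upperEnvelope hz
  · by_cases hT : 0 < T
    · exact hsub.exists_le_initial hH hF husc hlin hu₀
        (fun x hx => h0 (0, x) ⟨⟨le_rfl, hT⟩, hx⟩ rfl) he
    · exact ⟨0, le_rfl, fun z hz => absurd (hz.1.1.trans_lt hz.1.2) hT⟩

end HalfLineHJ

theorem theorem4p1 (H F u₀ : ℝ → ℝ)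
    (hH : Continuous H)
    (hF : ContDiff ℝ 1 F)
    (hF' : ∀ p : ℝ, deriv F p < 0)
    (hF0 : F 0 = 0)
    (hFbot : Tendsto F atBot atTop)
    (hFtop : Tendsto F atTop atBot)
    (hu₀ : UniformContinuousOn u₀ (Set.Ici 0))
    (T : ℝ) (hT : 0 < T)
    (u v : ℝ × ℝ → ℝ)
    (hu : HalfLineHJ.IsRelaxedSubsolution H F u₀ T u)
    (hv : HalfLineHJ.IsRelaxedSupersolution H F u₀ T v)
    (C : ℝ) (hC : 0 < C)
    (hub : ∀ t x : ℝ, 0 < t → t < T → 0 ≤ x → u (t, x) ≤ C * (1 + x))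
    (hvb : ∀ t x : ℝ, 0 < t → t < T → 0 ≤ x → -C * (1 + x) ≤ v (t, x)) :
    ∀ t x : ℝ, 0 ≤ t → t < T → 0 ≤ x → u (t, x) ≤ v (t, x) := by
  intro t x ht htT hx
  obtain ⟨hU, hUc, huU, hUi⟩ := hu.realEnvelope_spec hH hF.continuous hu₀ hub
  obtain ⟨hW, hWc, hvW, hWi⟩ := hv.neg.realEnvelope_spec (C := C)
    (hH.comp continuous_neg).neg (hF.continuous.comp continuous_neg).neg
    (uniformContinuous_neg.comp_uniformContinuousOn hu₀)
    (fun t x h0 h1 h2 => by linarith [hvb t x h0 h1 h2])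
  have hinit : ∀ e > 0, ∃ C₁, 0 ≤ C₁ ∧
      (∀ z ∈ HalfLineHJ.domain T, HalfLineHJ.realEnvelope T u z ≤ u₀ z.2 + e + C₁ * z.1) ∧
      ∀ z ∈ HalfLineHJ.domain T,
        HalfLineHJ.realEnvelope T (fun w => -v w) z ≤ -u₀ z.2 + e + C₁ * z.1 := by
    intro e he
    obtain ⟨c₁, hc₁, h1⟩ := hUi e he
    obtain ⟨c₂, hc₂, h2⟩ := hWi e he
    refine ⟨max c₁ c₂, le_max_of_le_left hc₁, fun z hz => ?_, fun z hz => ?_⟩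
    · exact (h1 z hz).trans (by gcongr; exacts [hz.1.1, le_max_left _ _])
    · exact (h2 z hz).trans (by gcongr; exacts [hz.1.1, le_max_right _ _])
  obtain ⟨c, hc, hUc1, hWc1⟩ := hinit 1 one_pos
  obtain ⟨L, hL, hLu⟩ := HalfLineHJ.exists_abs_sub_le_linear hu₀
  have hz : (t, x) ∈ HalfLineHJ.domain T := ⟨⟨ht, htT⟩, hx⟩
  have key := HalfLineHJ.add_nonpos_of_isViscositySubsolution hH hF hF' hFbot hFtop hu₀ hU hW
    hUc hWc hL (K := 4 + 2 * c * T) (by positivity)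
    (fun z hz w hw => by
      have h1 := hUc1 z hz
      have h2 := hWc1 w hw
      have h3 := (abs_le.1 (hLu z.2 w.2 hz.2 hw.2)).2
      have h4 : c * z.1 ≤ c * T := mul_le_mul_of_nonneg_left hz.1.2.le hc
      have h5 : c * w.1 ≤ c * T := mul_le_mul_of_nonneg_left hw.1.2.le hc
      linarith)
    hinit (t, x) hz
  linarith [huU _ hz, hvW _ hz]
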